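/- Let $k\ge 1$, and let $\theta=(\theta_1,\dots,\theta_k)$ be a vector of i.i.d. real random variables, each with density $f_0$ with respect to Lebesgue measure. Assume that $f_0$ has finite differential entropy, i.e. $\int_{\mathbb R} f_0|\log f_0|\,du<\infty$, where $\log$ denotes the base-2 logarithm throughout and $0\log 0=0$. Assume moreover that there is $M>0$ with $f_0(u)\le M$ for all $u\in\mathbb R$. Let $F_0$ be the cumulative distribution function of $\theta_1$ and $Q(p)=\inf\{u\in\mathbb R: p\le F_0(u)\}$ its quantile function (with $\inf\emptyset=+\infty$). The dyadic policy asks, at steps $n=1,2,\dots$, the questions $$A_n=\Bigl(\bigcup_{j=1}^{2^{n-1}}\bigl(Q(\tfrac{2j-1}{2^n}),\,Q(\tfrac{2j}{2^n})\bigr]\Bigr)\cap\{u\in\mathbb R: f_0(u)>0\},$$ and receives the answers $X_n=\sum_{i=1}^k \mathbb 1_{A_n}(\theta_i)$. Let $p_N$ be the posterior distribution, that is, the conditional distribution of $\theta$ given $X_1,\dots,X_N$. Then, almost surely, for every $N$, $p_N$ has a density on $\mathbb R^k$ and its differential entropy $H(p_N)=-\int_{\mathbb R^k}p_N(u)\log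 p_N(u)\,du$ is an absolutely convergent integral. Furthermore, $$\lim_{N\to\infty}\frac{H(p_N)}{N}=-H\bigl(\mathrm{Bin}(k,\tfrac12)\bigr)\quad\text{almost surely},$$ and $$\frac{H(p_N)+N\,H(\mathrm{Bin}(k,\frac12))}{\sqrt N}\ \longrightarrow\ \mathcal N(0,\sigma^2)\quad\text{in distribution as } N\to\infty,$$ where $H(\mathrm{Bin}(k,\frac12))$ is the Shannon entropy (in bits) of the binomial distribution, and $\sigma^2=\mathrm{Var}\bigl(\log\binom{k}{X}\bigr)$ with $X\sim\mathrm{Bin}(k,\frac12)$. (For $\sigma^2=0$, $\mathcal N(0,0)$ is the point mass at $0$.) -/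

import Mathlib

open MeasureTheory ProbabilityTheory Filter Topology

noncomputable section

namespace TwentyQuestions

/-- The distribution on `ℝ` with density `f` with respect to Lebesgue measure. -/
def densityMeasure (f : ℝ → ℝ) : Measure ℝ :=
  volume.withDensity (fun u => ENNReal.ofReal (f u))

/-- The quantile function `Q(p) = inf {u ∈ ℝ : p ≤ F(u)}` of the distribution with density `f`.
It takes values in the extended reals (`inf ∅ = +∞`), since `Q(1)` is infinite when the support
of `f` is unbounded above. -/
def quantile (f : ℝ → ℝ) (p : ℝ) : EReal :=
  sInf ((fun u : ℝ => (u : EReal)) '' {u : ℝ | p ≤ cdf (densityMeasure f) u})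

/-- The `n`-th question of the dyadic policy (`n ≥ 1`):
`A_n = (⋃_{j = 1}^{2^(n-1)} (Q((2j-1)/2^n), Q(2j/2^n)]) ∩ {u : f(u) > 0}`. -/
def dyadicQuestion (f : ℝ → ℝ) (n : ℕ) : Set ℝ :=
  (⋃ j ∈ Finset.Icc (1 : ℕ) (2 ^ (n - 1)),
    {u : ℝ | quantile f ((2 * (j : ℝ) - 1) / 2 ^ n) < (u : EReal) ∧
      (u : EReal) ≤ quantile f ((2 * (j : ℝ)) / 2 ^ n)}) ∩ {u : ℝ | 0 < f u}

variable {Ω : Type*} {k : ℕ}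

/-- The answer `1_A(θ_1) + ⋯ + 1_A(θ_k)` to the question `A`. -/
def answer (θ : Fin k → Ω → ℝ) (A : Set ℝ) (ω : Ω) : ℕ :=
  ∑ i, A.indicator (fun _ => 1) (θ i ω)

/-- The history `(X_1, …, X_N)` of the answers to the questions `A_1, …, A_N`. -/
def history (θ : Fin k → Ω → ℝ) (A : ℕ → Set ℝ) (N : ℕ) (ω : Ω) : Fin N → ℕ :=
  fun n => answer θ (A (n + 1)) ω

/-- The posterior `p_N`: the conditional distribution of `θ = (θ_1, …, θ_k)` given the answers
`(X_1, …, X_N)` to the (deterministic) questions `A_1, …, A_N`. It is a random measure. -/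
def posteriorLaw [MeasurableSpace Ω] (P : Measure Ω) [IsFiniteMeasure P]
    (θ : Fin k → Ω → ℝ) (A : ℕ → Set ℝ) (N : ℕ) (ω : Ω) : Measure (Fin k → ℝ) :=
  condDistrib (fun ω' i => θ i ω') (history θ A N) P (history θ A N ω)

/-- The function `u ↦ p(u) log₂ p(u)`, where `p` is the Lebesgue density of `ν`. -/
def entropyIntegrand (ν : Measure (Fin k → ℝ)) (u : Fin k → ℝ) : ℝ :=
  (ν.rnDeriv volume u).toReal * Real.logb 2 (ν.rnDeriv volume u).toReal

/-- `ν` has a Lebesgue density `p` and `p log₂ p` is integrable. -/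
def HasFiniteDiffEntropy (ν : Measure (Fin k → ℝ)) : Prop :=
  ν ≪ volume ∧ Integrable (entropyIntegrand ν) volume

/-- The differential entropy `H(ν) = -∫ p(u) log₂ p(u) du` in bits. -/
def diffEntropy (ν : Measure (Fin k → ℝ)) : ℝ :=
  -∫ u, entropyIntegrand ν u

/-- The Shannon entropy, in bits, of a distribution on `ℕ`. -/
def shannonEntropy (μ : Measure ℕ) : ℝ :=
  -∑' j : ℕ, μ.real {j} * Real.logb 2 (μ.real {j})

/-- The binomial distribution `Bin(k, 1/2)`. -/
def binHalf (k : ℕ) : Measure ℕ :=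
  binomial k ⟨1 / 2, by norm_num, by norm_num⟩

end TwentyQuestions

end

/-! The variable `F₀(θ_i)` is uniform on `[0, 1]`, and the question `A_n` reads its `n`-th binary
digit, up to a null set. Hence the digits, over all `i` and `n`, are independent fair coins, and the
answers `X_n`, which count ones in disjoint columns of this array, are i.i.d. `Bin(k, 1/2)`
(`iIndepFun_answer`, `hasLaw_answer`).

The history is a discrete function of `θ`, so the posterior is the prior restricted to the observed
event and renormalised. Its log-density is the prior log-density minus the log-probability of that
event, which gives (`ae_diffEntropy_posteriorLaw`) `H(p_N) = ∑_{n ≤ N} log P(X_n) - E[log ∏ f₀(θ_i)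
| X_1, …, X_N]`, where `P(X_n)` is the binomial mass at the observed value. The sum has i.i.d. terms
of mean `-H(Bin(k, 1/2))`. By Lévy's upward theorem the conditional expectations converge almost
surely, so they vanish after division by `N` or `√N`. The strong law, and the central limit theorem
with Slutsky's lemma, conclude (`limits_of_ae_eq_sum_sub`). -/

namespace TwentyQuestions

/-! ### Dyadic questions as binary digits of the distribution function. -/

section Quantile

variable {f : ℝ → ℝ}

theorem cdf_eq_real_Iic [IsProbabilityMeasure (densityMeasure f)] (u : ℝ) :
    cdf (densityMeasure f) u = (densityMeasure f).real (Set.Iic u) :=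
  cdf_eq_real _ u

instance nullSingletonClass_densityMeasure : NullSingletonClass (densityMeasure f) := by
  unfold densityMeasure; infer_instance

/-- The jump at a point is the mass of that point, and a measure with a density has no atoms. -/
theorem continuous_cdf_densityMeasure [IsProbabilityMeasure (densityMeasure f)] :
    Continuous (cdf (densityMeasure f)) := by
  rw [continuous_iff_continuousAt]
  intro x
  rw [(cdf (densityMeasure f)).mono.continuousAt_iff_leftLim_eq_rightLim, StieltjesFunction.rightLim_eq]
  have h := (cdf (densityMeasure f)).measure_singleton x
  rw [measure_cdf, measure_singleton] at h
  have h2 := (cdf (densityMeasure f)).mono.leftLim_le (le_refl x)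
  have h3 := ENNReal.ofReal_eq_zero.1 h.symm
  linarith

/-- The quantile and the distribution function form a Galois pair. -/
theorem quantile_le_iff (p : ℝ) (u : ℝ) :
    quantile f p ≤ u ↔ p ≤ cdf (densityMeasure f) u := by
  constructor
  · intro h
    -- The infimum is not known to be attained, so the bound is first obtained to the right of `u`
    -- and then passes to `u` by right continuity.
    have key : ∀ v > u, p ≤ cdf (densityMeasure f) v := by
      intro v hv
      have h1 : quantile f p < (v : EReal) := h.trans_lt (by exact_mod_cast hv)
      obtain ⟨_, ⟨w, hw, rfl⟩, hwv⟩ := sInf_lt_iff.1 h1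
      have : w < v := EReal.coe_lt_coe_iff.1 hwv
      exact hw.trans ((cdf (densityMeasure f)).mono this.le)
    have hr : Tendsto (cdf (densityMeasure f)) (𝓝[>] u) (𝓝 (cdf (densityMeasure f) u)) :=
      ((cdf (densityMeasure f)).right_continuous u).mono_left
        (nhdsWithin_mono _ Set.Ioi_subset_Ici_self)
    exact ge_of_tendsto hr (eventually_nhdsWithin_of_forall fun v hv => key v hv)
  · intro h
    exact sInf_le ⟨u, h, rfl⟩

/-- The distribution function of a real variable with a density is uniformly distributed. -/
theorem measure_cdf_lt [IsProbabilityMeasure (densityMeasure f)] {p : ℝ} (hp0 : 0 ≤ p) (hp1 : p ≤ 1) :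
    (densityMeasure f).real {u | cdf (densityMeasure f) u < p} = p := by
  set F := cdf (densityMeasure f) with hF
  have hcont : Continuous F := continuous_cdf_densityMeasure
  -- Intermediate value theorem; the values 0 and 1 are excluded because they need not be attained.
  have hex : ∀ q, 0 < q → q < 1 → ∃ x, F x = q := by
    intro q h0 h1
    obtain ⟨a, ha⟩ := ((tendsto_cdf_atBot (densityMeasure f)).eventually (gt_mem_nhds h0)).exists
    obtain ⟨b, hb⟩ := ((tendsto_cdf_atTop (densityMeasure f)).eventually (lt_mem_nhds h1)).exists
    exact mem_range_of_exists_le_of_exists_ge hcont ⟨a, ha.le⟩ ⟨b, hb.le⟩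
  have hle : (densityMeasure f).real {u | F u < p} ≤ p := by
    rcases hp1.eq_or_lt with rfl | hp1
    · exact measureReal_le_one
    rcases hp0.eq_or_lt with rfl | hp0
    · have : {u | F u < 0} = ∅ := by
        ext u; simpa using cdf_nonneg _ u
      simp [this]
    obtain ⟨x, hx⟩ := hex p hp0 hp1
    calc _ ≤ (densityMeasure f).real (Set.Iic x) := by
          refine measureReal_mono fun u hu => ?_
          by_contra hxu
          have := F.mono (le_of_not_ge hxu)
          simp only [Set.mem_ofPred_eq] at hu
          linarith
      _ = p := by rw [← cdf_eq_real_Iic, ← hx]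
  -- An intermediate level `r < p` is needed because `F u ≤ F x` is not strict: with `F x = r`, all
  -- of `Iic x` lies in `{F < p}`.
  refine le_antisymm hle (le_of_forall_lt fun q hq => ?_)
  obtain ⟨r, hqr, hrp⟩ := exists_between hq
  rcases le_or_gt 0 q with h0 | h0
  · obtain ⟨x, hx⟩ := hex r (by linarith) (by linarith)
    calc q < r := hqr
      _ = (densityMeasure f).real (Set.Iic x) := by rw [← cdf_eq_real_Iic, ← hx]
      _ ≤ _ := by
          refine measureReal_mono fun u hu => ?_
          have := F.mono (show u ≤ x from hu)
          simp only [Set.mem_ofPred_eq]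
          linarith
  · exact h0.trans_le measureReal_nonneg

/-- Points with `F u = 1` must be discarded: there `⌊2^N F u⌋` equals `2^N`, which is not the index
of a dyadic cell. -/
theorem ae_cdf_lt_one [IsProbabilityMeasure (densityMeasure f)] :
    ∀ᵐ u ∂(densityMeasure f), cdf (densityMeasure f) u < 1 := by
  have h := measure_cdf_lt (f := f) zero_le_one le_rfl
  have hm : MeasurableSet {u | cdf (densityMeasure f) u < 1} :=
    measurableSet_lt (cdf (densityMeasure f)).mono.measurable measurable_const
  rw [ae_iff, show {u | ¬cdf (densityMeasure f) u < 1} = {u | cdf (densityMeasure f) u < 1}ᶜ from rfl,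
    prob_compl_eq_zero_iff hm]
  rw [measureReal_def] at h
  exact (ENNReal.toReal_eq_one_iff _).1 h

theorem ae_density_pos (hf : Measurable f) : ∀ᵐ u ∂(densityMeasure f), 0 < f u := by
  unfold densityMeasure
  rw [ae_withDensity_iff hf.ennreal_ofReal]
  exact Eventually.of_forall fun u hu => by
    by_contra h
    exact hu (ENNReal.ofReal_eq_zero.2 (not_lt.1 h))

/-- Almost surely, the `n`-th dyadic question asks for the `n`-th binary digit of `F(u)`. -/
theorem ae_mem_dyadicQuestion_iff (hf : Measurable f) [IsProbabilityMeasure (densityMeasure f)]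
    (n : ℕ) :
    ∀ᵐ u ∂(densityMeasure f), (u ∈ dyadicQuestion f (n + 1) ↔
      ⌊2 ^ (n + 1) * cdf (densityMeasure f) u⌋₊ % 2 = 1) := by
  -- Each quantile equals at most one real, and points are null. Off these points the Galois
  -- inequality `Q(p) ≤ u` may be replaced by the strict one in the question.
  have hne : ∀ᵐ (u : ℝ) ∂(densityMeasure f), ∀ p : ℕ, quantile f (p / 2 ^ (n + 1)) ≠ (u : EReal) := by
    rw [ae_all_iff]
    intro p
    have hs : {u : ℝ | ¬ quantile f (p / 2 ^ (n + 1)) ≠ (u : EReal)}.Subsingleton := by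
      intro a ha b hb
      exact EReal.coe_injective ((not_not.1 ha).symm.trans (not_not.1 hb))
    exact hs.measure_zero (densityMeasure f)
  filter_upwards [hne, ae_cdf_lt_one, ae_density_pos hf] with u hu hu1 hfu
  set F := cdf (densityMeasure f) u with hF
  have hF0 : 0 ≤ F := cdf_nonneg _ _
  have hpow : (0 : ℝ) < 2 ^ (n + 1) := by positivity
  have hlt : ∀ p : ℕ, 0 < p → (quantile f (p / 2 ^ (n + 1)) < (u : EReal) ↔ p ≤ ⌊2 ^ (n + 1) * F⌋₊) := by
    intro p hp
    have hp' : (0 : ℝ) < p := by exact_mod_cast hp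
    rw [lt_iff_le_and_ne, and_iff_left (hu p), quantile_le_iff, div_le_iff₀ hpow,
      Nat.le_floor_iff (by positivity), mul_comm]
  have hgt : ∀ p : ℕ, 0 < p → ((u : EReal) ≤ quantile f (p / 2 ^ (n + 1)) ↔ ⌊2 ^ (n + 1) * F⌋₊ < p) := by
    intro p hp
    rw [← not_lt, hlt p hp, not_le]
  have hm : ⌊2 ^ (n + 1) * F⌋₊ < 2 * 2 ^ n := by
    rw [Nat.floor_lt (by positivity)]
    push_cast
    rw [← pow_succ']
    nlinarith
  set m := ⌊2 ^ (n + 1) * F⌋₊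
  simp only [dyadicQuestion, Set.mem_inter_iff, Set.mem_ofPred_eq, hfu, and_true, Set.mem_iUnion,
    Finset.mem_Icc, Nat.add_sub_cancel, exists_prop]
  have hcast : ∀ j : ℕ, 1 ≤ j → (2 * (j : ℝ) - 1) = ((2 * j - 1 : ℕ) : ℝ) := by
    intro j hj
    rw [Nat.cast_sub (by omega)]; push_cast; ring
  have hcast2 : ∀ j : ℕ, (2 * (j : ℝ)) = ((2 * j : ℕ) : ℝ) := by intro j; push_cast; ring
  -- The `j`-th interval is now `2j - 1 ≤ m < 2j`, that is, `m = 2j - 1`; this forces `m` odd and `j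
  -- = (m + 1) / 2`.
  constructor
  · rintro ⟨j, ⟨hj1, hj2⟩, h1, h2⟩
    rw [hcast j hj1, hlt _ (by omega)] at h1
    rw [hcast2, hgt _ (by omega)] at h2
    omega
  · intro h
    refine ⟨(m + 1) / 2, ⟨by omega, by omega⟩, ?_, ?_⟩
    · rw [hcast _ (by omega), hlt _ (by omega)]; omega
    · rw [hcast2, hgt _ (by omega)]; omega

theorem measurableSet_dyadicQuestion (hf : Measurable f) (n : ℕ) :
    MeasurableSet (dyadicQuestion f n) := by
  refine MeasurableSet.inter (Finset.measurableSet_biUnion _ fun j _ => ?_)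
    (measurableSet_lt measurable_const hf)
  exact (measurableSet_lt measurable_const measurable_coe_real_ereal).inter
    (measurableSet_le measurable_coe_real_ereal measurable_const)

/-- Prescribing the first `N` binary digits of a number in `[0, 1)` fixes `⌊2^N x⌋`. -/
theorem exists_floor_eq_iff (b : ℕ → Prop) (N : ℕ) :
    ∃ m < 2 ^ N, ∀ x : ℝ, 0 ≤ x → x < 1 →
      ((∀ n < N, (⌊2 ^ (n + 1) * x⌋₊ % 2 = 1 ↔ b n)) ↔ ⌊2 ^ N * x⌋₊ = m) := by
  induction N with
  | zero =>
    refine ⟨0, by simp, fun x h0 h1 => ?_⟩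
    simp [Nat.floor_eq_zero, h1]
  | succ N ih =>
    classical
    obtain ⟨m, hm, h⟩ := ih
    -- Appending a digit: the parity of `⌊2^(N+1) x⌋` is the new digit and its half is the previous
    -- floor.
    refine ⟨2 * m + if b N then 1 else 0, by split_ifs <;> omega, fun x h0 h1 => ?_⟩
    have hdiv : ⌊2 ^ N * x⌋₊ = ⌊2 ^ (N + 1) * x⌋₊ / 2 := by
      rw [← Nat.floor_div_ofNat]; congr 1; rw [pow_succ]
      ring
    rw [Nat.forall_lt_succ_right, h x h0 h1, hdiv]
    split_ifs with hb <;> simp only [hb, iff_true, iff_false] <;> omega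

/-- All digit patterns of length `N` are equally likely. -/
theorem measure_forall_mem_dyadicQuestion (hf : Measurable f)
    [IsProbabilityMeasure (densityMeasure f)] (b : ℕ → Prop) (N : ℕ) :
    densityMeasure f {u | ∀ n < N, (u ∈ dyadicQuestion f (n + 1) ↔ b n)} = (2⁻¹) ^ N := by
  obtain ⟨m, hm, h⟩ := exists_floor_eq_iff b N
  set F := cdf (densityMeasure f) with hF
  -- A digit pattern is a dyadic cell `[m / 2^N, (m + 1) / 2^N)` for `F u`, written as a difference
  -- of sublevel sets.
  have hae : {u | ∀ n < N, (u ∈ dyadicQuestion f (n + 1) ↔ b n)} =ᵐ[densityMeasure f]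
      ({u | F u < (m + 1 : ℝ) / 2 ^ N} \ {u | F u < (m : ℝ) / 2 ^ N} : Set ℝ) := by
    have hq := ae_all_iff.2 fun n => ae_mem_dyadicQuestion_iff hf n
    rw [Filter.eventuallyEq_set]
    filter_upwards [hq, ae_cdf_lt_one (f := f)] with u hu hu1
    have hpow : (0 : ℝ) < 2 ^ N := by positivity
    have hF0 : 0 ≤ F u := cdf_nonneg _ _
    simp only [Set.mem_ofPred_eq, Set.mem_sdiff, hu, not_lt]
    rw [h _ hF0 hu1, Nat.floor_eq_iff (by positivity), div_le_iff₀ hpow, lt_div_iff₀ hpow,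
      mul_comm (2 ^ N), and_comm]
  have hpow : (0 : ℝ) < 2 ^ N := by positivity
  have hm' : (m + 1 : ℝ) ≤ 2 ^ N := by exact_mod_cast hm
  have hreal : (densityMeasure f).real {u | ∀ n < N, (u ∈ dyadicQuestion f (n + 1) ↔ b n)}
      = (2⁻¹) ^ N := by
    rw [measureReal_congr hae, measureReal_sdiff _ (measurableSet_lt F.mono.measurable measurable_const)]
    · rw [measure_cdf_lt (by positivity) ((div_le_one hpow).2 hm'),
        measure_cdf_lt (by positivity) ((div_le_one hpow).2 (by linarith))]
      rw [inv_pow]; field_simp; ring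
    · intro u hu
      simp only [Set.mem_ofPred_eq] at *
      refine hu.trans ?_
      gcongr; linarith
  rw [measureReal_def] at hreal
  rw [← ENNReal.ofReal_toReal (measure_ne_top (densityMeasure f) _), hreal,
    ENNReal.ofReal_pow (by norm_num), ENNReal.ofReal_inv_of_pos (by norm_num)]
  simp

end Quantile

/-! ### Independent fair coins from equally likely patterns. -/

section CoinTossing

variable {Ω : Type*} [MeasurableSpace Ω] {P : Measure Ω}

/-- The fair coin, as a distribution on propositions. -/
noncomputable def fairCoin : Measure Prop :=
  (2⁻¹ : ENNReal) • Measure.dirac True + (2⁻¹ : ENNReal) • Measure.dirac False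

instance isProbabilityMeasure_fairCoin : IsProbabilityMeasure fairCoin :=
  ⟨by simp [fairCoin, ENNReal.inv_two_add_inv_two]⟩

theorem fairCoin_singleton (q : Prop) : fairCoin {q} = 2⁻¹ := by
  by_cases hq : q <;> simp [fairCoin, hq]

theorem hasLaw_pi_fairCoin {X : ℕ → Ω → Prop} (hX : ∀ n, Measurable (X n))
    (h : ∀ (b : ℕ → Prop) (N : ℕ), P {ω | ∀ n < N, (X n ω ↔ b n)} = (2⁻¹) ^ N) (N : ℕ) :
    HasLaw (fun ω (i : Fin N) => X i ω) (Measure.pi fun _ => fairCoin) P where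
  aemeasurable := by fun_prop
  map_eq := by
    refine Measure.ext_of_singleton fun b => ?_
    rw [Measure.pi_singleton, Measure.map_apply (by fun_prop) (measurableSet_singleton _)]
    simp only [fairCoin_singleton, Finset.prod_const, Finset.card_univ, Fintype.card_fin]
    -- The finite pattern is extended by `False` beyond `N`.
    rw [← h (fun n => ∃ hn : n < N, b ⟨n, hn⟩) N]
    congr 1
    ext ω
    simp only [Set.mem_preimage, Set.mem_singleton_iff, Set.mem_ofPred_eq, funext_iff, eq_iff_iff]
    exact ⟨fun H n hn => by simpa [hn] using H ⟨n, hn⟩,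
      fun H i => by simpa using H i i.2⟩

theorem hasLaw_fairCoin {X : ℕ → Ω → Prop} (hX : ∀ n, Measurable (X n))
    (h : ∀ (b : ℕ → Prop) (N : ℕ), P {ω | ∀ n < N, (X n ω ↔ b n)} = (2⁻¹) ^ N) (n : ℕ) :
    HasLaw (X n) fairCoin P :=
  (measurePreserving_eval (fun _ : Fin (n + 1) => fairCoin) (Fin.last n)).comp_hasLaw
    (hasLaw_pi_fairCoin hX h (n + 1))

/-- Every finite set of indices lies in an initial segment, where the joint law is the product of
fair coins. -/
theorem iIndepFun_of_measure_pattern [IsProbabilityMeasure P] {X : ℕ → Ω → Prop}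
    (hX : ∀ n, Measurable (X n))
    (h : ∀ (b : ℕ → Prop) (N : ℕ), P {ω | ∀ n < N, (X n ω ↔ b n)} = (2⁻¹) ^ N) :
    iIndepFun X P := by
  rw [iIndepFun_iff_finset]
  intro s
  have hs : ∀ i ∈ s, i < s.sup id + 1 := fun i hi =>
    Nat.lt_succ_of_le (Finset.le_sup (f := id) hi)
  have hN : iIndepFun (fun (i : Fin (s.sup id + 1)) ω => X i ω) P :=
  
    (iIndepFun_iff_hasLaw_pi_pi fun i : Fin (s.sup id + 1) => hasLaw_fairCoin hX h i).2
      (hasLaw_pi_fairCoin hX h _)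
  exact hN.precomp (g := fun i : s => ⟨i, hs i i.2⟩) fun i j hij => Subtype.ext (by simpa using hij)

/-- Grouping a doubly indexed independent family into blocks keeps the blocks independent. -/
theorem iIndepFun_curry {ι κ : Type*} {E : Type*} [MeasurableSpace E] {X : ι → κ → Ω → E}
    [IsProbabilityMeasure P] (hX : ∀ i j, Measurable (X i j))
    (h : iIndepFun (fun (p : (_ : ι) × κ) ω => X p.1 p.2 ω) P) :
    iIndepFun (fun i ω j => X i j ω) P := by
  have : ∀ i j, IsProbabilityMeasure (P.map (X i j)) :=
    fun i j => Measure.isProbabilityMeasure_map (hX i j).aemeasurable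
  have hcurry : (fun ω i j => X i j ω) =
      (MeasurableEquiv.piCurry fun (_ : ι) (_ : κ) => E) ∘
        (fun ω (p : (_ : ι) × κ) => X p.1 p.2 ω) := by
    ext; simp [Sigma.curry]
  rw [iIndepFun_iff_map_fun_eq_infinitePi_map (by fun_prop), hcurry,
    ← Measure.map_map (by fun_prop) (by fun_prop),
    (iIndepFun_iff_map_fun_eq_infinitePi_map (by fun_prop)).1 h,
    Measure.infinitePi_map_piCurry (fun i j => P.map (X i j))]
  congrm Measure.infinitePi fun i => ?_
  have hi : iIndepFun (X i) P :=
    h.precomp (g := fun j => (⟨i, j⟩ : (_ : ι) × κ)) fun j j' hj => by simpa using hj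
  rw [(iIndepFun_iff_map_fun_eq_infinitePi_map (by fun_prop)).1 hi]

end CoinTossing

/-! ### The answers are i.i.d. binomial. -/

section Answers

variable {Ω : Type*} [MeasurableSpace Ω] {P : Measure Ω} {k : ℕ}
  {f : ℝ → ℝ} {θ : Fin k → Ω → ℝ}

open Classical in
theorem answer_eq_card {Ω : Type*} (θ : Fin k → Ω → ℝ) (A : Set ℝ) (ω : Ω) :
    answer θ A ω = (Finset.univ.filter fun i => θ i ω ∈ A).card := by
  simp only [answer, Set.indicator_apply, Finset.card_filter]

theorem isProbabilityMeasure_densityMeasure [IsProbabilityMeasure P] (hk : 1 ≤ k) (hθ : ∀ i, Measurable (θ i))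
    (hlaw : ∀ i, P.map (θ i) = densityMeasure f) : IsProbabilityMeasure (densityMeasure f) := by
  rw [← hlaw ⟨0, hk⟩]
  exact Measure.isProbabilityMeasure_map (hθ _).aemeasurable

theorem measurable_mem_dyadicQuestion (hf : Measurable f) {X : Ω → ℝ} (hX : Measurable X) (n : ℕ) :
    Measurable fun ω => X ω ∈ dyadicQuestion f n :=
  (measurable_mem.2 (measurableSet_dyadicQuestion hf n)).comp hX

theorem measure_digit_pattern (hf : Measurable f) [IsProbabilityMeasure (densityMeasure f)]
    {X : Ω → ℝ} (hX : Measurable X) (hlaw : P.map X = densityMeasure f) (b : ℕ → Prop) (N : ℕ) :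
    P {ω | ∀ n < N, (X ω ∈ dyadicQuestion f (n + 1) ↔ b n)} = (2⁻¹) ^ N := by
  have hm : MeasurableSet {u : ℝ | ∀ n < N, (u ∈ dyadicQuestion f (n + 1) ↔ b n)} := by
    simp only [measurableSet_setOfPred]
    have := fun n => measurable_mem.2 (measurableSet_dyadicQuestion hf (n + 1))
    refine Measurable.forall fun n => Measurable.forall fun _ => ?_
    exact (this n).iff measurable_const
  rw [← measure_forall_mem_dyadicQuestion hf b N, ← hlaw, Measure.map_apply hX hm]
  rfl

/-- The number of heads among `k` fair coins is binomial. -/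
theorem map_card_pi_fairCoin [∀ b : Fin k → Prop, DecidablePred b] :
    (Measure.pi fun _ : Fin k => fairCoin).map (fun b => (Finset.univ.filter b).card) =
      binHalf k := by
  classical
  refine Measure.ext_of_singleton fun j => ?_
  -- Patterns with `j` heads correspond to `j`-element subsets of `Fin k`, each pattern having mass
  -- `2^(-k)`.
  have hset : (fun b : Fin k → Prop => (Finset.univ.filter b).card) ⁻¹' {j} =
      (((Finset.univ : Finset (Fin k)).powersetCard j).image
        (fun s i => i ∈ s) : Finset (Fin k → Prop)) := by
    ext b
    simp only [Set.mem_preimage, Set.mem_singleton_iff, Finset.coe_image, Set.mem_image,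
      Finset.mem_coe, Finset.mem_powersetCard_univ]
    constructor
    · intro h
      exact ⟨Finset.univ.filter b, h, by ext i; simp⟩
    · rintro ⟨s, hs, rfl⟩
      rw [← hs]; congr 1; ext i; simp
  rw [Measure.map_apply .of_discrete (measurableSet_singleton _), hset, ← sum_measure_singleton,
    Finset.sum_image]
  · simp only [Measure.pi_singleton, fairCoin_singleton, Finset.prod_const, Finset.card_univ,
      Fintype.card_fin, Finset.sum_const, Finset.card_powersetCard, nsmul_eq_mul]
    rw [binHalf, binomial_singleton]
    rcases le_or_gt j k with hj | hj
    · simp only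
      rw [show (1 - 1 / 2 : ℝ) = 1 / 2 by norm_num, mul_assoc, ← pow_add, Nat.add_sub_cancel' hj,
        ENNReal.ofReal_mul (by positivity), ENNReal.ofReal_pow (by norm_num), one_div,
        ENNReal.ofReal_inv_of_pos (by norm_num)]
      simp
    · simp [Nat.choose_eq_zero_of_lt hj]
  · intro s _ t _ hst
    ext i
    exact (congrFun hst i).to_iff

variable [IsProbabilityMeasure P] (hk : 1 ≤ k) (hf : Measurable f) (hθ : ∀ i, Measurable (θ i)) (hind : iIndepFun θ P)
  (hlaw : ∀ i, P.map (θ i) = densityMeasure f)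

include hk hf hθ hind hlaw

/-- Digits are independent across `i` by hypothesis and across `n` by equally likely patterns, hence
jointly over pairs; the array is then regrouped by `n` instead of `i`. -/
theorem iIndepFun_digits :
    iIndepFun (fun (n : ℕ) ω (i : Fin k) => θ i ω ∈ dyadicQuestion f (n + 1)) P := by
  have := isProbabilityMeasure_densityMeasure hk hθ hlaw
  have hm : ∀ i n, Measurable fun ω => θ i ω ∈ dyadicQuestion f (n + 1) :=
    fun i n => measurable_mem_dyadicQuestion hf (hθ i) (n + 1)
  have h1 : iIndepFun (fun i ω (n : ℕ) => θ i ω ∈ dyadicQuestion f (n + 1)) P :=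
    hind.comp (fun _ u n => u ∈ dyadicQuestion f (n + 1)) fun _ =>
      measurable_pi_iff.2 fun n => measurable_mem.2 (measurableSet_dyadicQuestion hf (n + 1))
  have h2 : ∀ i, iIndepFun (fun (n : ℕ) ω => θ i ω ∈ dyadicQuestion f (n + 1)) P := fun i =>
    iIndepFun_of_measure_pattern (hm i) (measure_digit_pattern hf (hθ i) (hlaw i))
  have h3 := iIndepFun_uncurry (X := fun i (n : ℕ) ω => θ i ω ∈ dyadicQuestion f (n + 1)) hm h1 h2
  refine iIndepFun_curry (X := fun (n : ℕ) i ω => θ i ω ∈ dyadicQuestion f (n + 1))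
    (fun n i => hm i n) ?_
  exact h3.precomp (g := fun p : (_ : ℕ) × Fin k => (⟨p.2, p.1⟩ : (_ : Fin k) × ℕ)) fun p q hpq => by
    simp only [Sigma.mk.injEq, heq_eq_eq] at hpq
    exact Sigma.ext hpq.2 (heq_of_eq hpq.1)

/-- The answers to the dyadic questions are independent. -/
theorem iIndepFun_answer :
    iIndepFun (fun (n : ℕ) => answer θ (dyadicQuestion f (n + 1))) P := by
  classical
  have h := (iIndepFun_digits hk hf hθ hind hlaw).comp
    (fun _ b => (Finset.univ.filter b).card) fun _ => .of_discrete
  have hcard : (fun n : ℕ => answer θ (dyadicQuestion f (n + 1))) =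
      fun n ω => (Finset.univ.filter fun i => θ i ω ∈ dyadicQuestion f (n + 1)).card := by
    funext n ω
    exact answer_eq_card θ _ ω
  rw [hcard]
  exact h

/-- The answer to each dyadic question is binomial. -/
theorem hasLaw_answer (n : ℕ) :
    HasLaw (answer θ (dyadicQuestion f (n + 1))) (binHalf k) P := by
  classical
  have := isProbabilityMeasure_densityMeasure hk hθ hlaw
  have hm : ∀ i n, Measurable fun ω => θ i ω ∈ dyadicQuestion f (n + 1) :=
    fun i n => measurable_mem_dyadicQuestion hf (hθ i) (n + 1)
  have hlaw1 : ∀ i, HasLaw (fun ω => θ i ω ∈ dyadicQuestion f (n + 1)) fairCoin P := fun i =>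
    hasLaw_fairCoin (hm i) (measure_digit_pattern hf (hθ i) (hlaw i)) n
  have hi : iIndepFun (fun i ω => θ i ω ∈ dyadicQuestion f (n + 1)) P :=
    hind.comp (fun _ u => u ∈ dyadicQuestion f (n + 1)) fun _ =>
      measurable_mem.2 (measurableSet_dyadicQuestion hf (n + 1))
  have hpi := hi.hasLaw_pi hlaw1
  have hcard : HasLaw (fun b : Fin k → Prop => (Finset.univ.filter b).card) (binHalf k)
      (Measure.pi fun _ => fairCoin) := ⟨Measurable.of_discrete.aemeasurable, map_card_pi_fairCoin⟩
  refine (hcard.comp hpi).congr (Eventually.of_forall fun ω => ?_)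
  exact answer_eq_card θ _ ω

end Answers
-- Density and integrable log-density of the prior.
section ProductDensity

theorem lintegral_fin_prod {n : ℕ} {g : Fin n → ℝ → ENNReal} (hg : ∀ i, Measurable (g i)) :
    ∫⁻ x : Fin n → ℝ, ∏ i, g i (x i) = ∏ i, ∫⁻ t, g i t := by
  induction n with
  | zero => simp [volume_pi]
  | succ n ih =>
    have hm : Measurable fun x : Fin n → ℝ => ∏ i, g i.succ (x i) :=
      Finset.measurable_prod _ fun i _ => (hg _).comp (measurable_pi_apply i)
    rw [← (volume_preserving_piFinSuccAbove (fun _ : Fin (n + 1) => ℝ) 0).symm.lintegral_comp_emb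
      (MeasurableEquiv.measurableEmbedding _)]
    simp only [Fin.prod_univ_succ, MeasurableEquiv.piFinSuccAbove_symm_apply, Fin.insertNthEquiv_zero,
      Fin.consEquiv_apply, Fin.cons_zero, Fin.cons_succ]
    rw [Measure.volume_eq_prod, lintegral_prod_mul (f := g 0) (g := fun x : Fin n → ℝ => ∏ i : Fin n, g i.succ (x i))
      (hg 0).aemeasurable hm.aemeasurable, ih fun i => hg i.succ]

/-- The product of distributions with densities has the product density. -/
theorem pi_densityMeasure {k : ℕ} {f : ℝ → ℝ} (hf : Measurable f)
    [IsProbabilityMeasure (densityMeasure f)] :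
    (Measure.pi fun _ : Fin k => densityMeasure f) =
      volume.withDensity fun u : Fin k → ℝ => ∏ i, ENNReal.ofReal (f (u i)) := by
  refine (Measure.pi_eq fun s hs => ?_)
  rw [withDensity_apply _ (MeasurableSet.univ_pi hs), ← lintegral_indicator (MeasurableSet.univ_pi hs)]
  have h : (Set.univ.pi s).indicator (fun u : Fin k → ℝ => ∏ i, ENNReal.ofReal (f (u i))) =
      fun u => ∏ i, (s i).indicator (fun t => ENNReal.ofReal (f t)) (u i) := by
    classical
    funext u
    by_cases hu : ∀ i, u i ∈ s i
    · rw [Set.indicator_of_mem (by simpa [Set.mem_pi] using hu)]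
      exact Finset.prod_congr rfl fun i _ =>
        (Set.indicator_of_mem (hu i) fun t => ENNReal.ofReal (f t)).symm
    · rw [Set.indicator_of_notMem (by simpa [Set.mem_pi] using hu)]
      obtain ⟨i, hi⟩ := not_forall.1 hu
      exact (Finset.prod_eq_zero (Finset.mem_univ i) (Set.indicator_of_notMem hi _)).symm
  rw [h, lintegral_fin_prod fun i => hf.ennreal_ofReal.indicator (hs i)]
  refine Finset.prod_congr rfl fun i _ => ?_
  rw [lintegral_indicator (hs i), densityMeasure, withDensity_apply _ (hs i)]

theorem integrable_logb_density {f : ℝ → ℝ} (hf : Measurable f) (hf0 : ∀ u, 0 ≤ f u)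
    (hent : Integrable fun u => f u * Real.logb 2 (f u)) :
    Integrable (fun u => Real.logb 2 (f u)) (densityMeasure f) := by
  unfold densityMeasure
  rw [integrable_withDensity_iff_integrable_smul' hf.ennreal_ofReal (by simp)]
  simpa [ENNReal.toReal_ofReal (hf0 _)] using hent

/-- Almost surely every factor is positive, so the logarithm of the product splits into a sum of
one-coordinate integrable functions. -/
theorem integrable_logb_prod_density {k : ℕ} {f : ℝ → ℝ} (hf : Measurable f) (hf0 : ∀ u, 0 ≤ f u)
    [IsProbabilityMeasure (densityMeasure f)]
    (hent : Integrable fun u => f u * Real.logb 2 (f u)) :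
    Integrable (fun u : Fin k → ℝ => Real.logb 2 (∏ i, f (u i)))
      (Measure.pi fun _ : Fin k => densityMeasure f) := by
  have hev : ∀ i, MeasurePreserving (fun u : Fin k → ℝ => u i)
      (Measure.pi fun _ : Fin k => densityMeasure f) (densityMeasure f) :=
    fun i => measurePreserving_eval (fun _ : Fin k => densityMeasure f) i
  have hsum : Integrable (fun u : Fin k → ℝ => ∑ i, Real.logb 2 (f (u i)))
      (Measure.pi fun _ : Fin k => densityMeasure f) :=
    integrable_finsetSum _ fun i _ =>
      (hev i).integrable_comp_of_integrable (integrable_logb_density hf hf0 hent)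
  refine hsum.congr ?_
  have hpos : ∀ᵐ u ∂(Measure.pi fun _ : Fin k => densityMeasure f), ∀ i, 0 < f (u i) :=
    ae_all_iff.2 fun i => (hev i).quasiMeasurePreserving.ae (ae_density_pos hf)
  filter_upwards [hpos] with u hu
  simp only [Real.logb, ← Finset.sum_div]
  rw [Real.log_prod fun i _ => (hu i).ne']

end ProductDensity

/-! ### Entropy of a law conditioned on an event. -/

section Conditioning

/-- Conditioning a random variable on the value of a function of it restricts its law. -/
theorem condDistrib_comp_of_ne_zero {Ω E β : Type*} [MeasurableSpace Ω] [MeasurableSpace E]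
    [StandardBorelSpace E] [Nonempty E] [MeasurableSpace β] [MeasurableSingletonClass β]
    {P : Measure Ω} [IsFiniteMeasure P] {Y : Ω → E} (hY : Measurable Y) {h : E → β}
    (hh : Measurable h) {x : β} (hx : P.map (fun ω => h (Y ω)) {x} ≠ 0) :
    condDistrib Y (fun ω => h (Y ω)) P x =
      (P.map (fun ω => h (Y ω)) {x})⁻¹ • (P.map Y).restrict (h ⁻¹' {x}) := by
  have hhY : Measurable fun ω => h (Y ω) := hh.comp hY
  ext s hs
  rw [condDistrib_apply_of_ne_zero hY x hx, Measure.smul_apply, smul_eq_mul,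
    Measure.restrict_apply hs, Measure.map_apply (hhY.prodMk hY)
      ((measurableSet_singleton x).prod hs), Measure.map_apply hY (hs.inter (hh (measurableSet_singleton x)))]
  congr 2
  ext ω
  simp [and_comm]

variable {k : ℕ} {ν : Measure (Fin k → ℝ)} [IsProbabilityMeasure ν] {g : (Fin k → ℝ) → ENNReal}
  {E : Set (Fin k → ℝ)}

/-- The entropy of a distribution with density `g` conditioned on an event `E`. -/
theorem diffEntropy_cond (hg : Measurable g) (hgtop : ∀ u, g u ≠ ⊤) (hν : ν = volume.withDensity g)
    (hE : MeasurableSet E) (hE0 : ν E ≠ 0) (hint : Integrable (fun u => Real.logb 2 (g u).toReal) ν) :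
    HasFiniteDiffEntropy ((ν E)⁻¹ • ν.restrict E) ∧
      diffEntropy ((ν E)⁻¹ • ν.restrict E) =
        Real.logb 2 (ν.real E) - ∫ u, Real.logb 2 (g u).toReal ∂((ν E)⁻¹ • ν.restrict E) := by
  set ρ := (ν E)⁻¹ • ν.restrict E with hρ
  have hctop : (ν E)⁻¹ ≠ ⊤ := ENNReal.inv_ne_top.2 hE0
  have hprob : IsProbabilityMeasure ρ :=
    ⟨by simp [hρ, ENNReal.inv_mul_cancel hE0 (measure_ne_top ν E)]⟩
  have hρd : ρ = volume.withDensity ((ν E)⁻¹ • E.indicator g) := by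
    rw [withDensity_smul _ (hg.indicator hE), withDensity_indicator hE, ← restrict_withDensity hE,
      ← hν]
  have hac : ρ ≪ volume := by rw [hρd]; exact withDensity_absolutelyContinuous _ _
  have hρν : ρ ≪ ν := (Measure.absolutelyContinuous_of_le Measure.restrict_le_self).smul_left _
  have hrn : ρ.rnDeriv volume =ᵐ[volume] (ν E)⁻¹ • E.indicator g := by
    conv_lhs => rw [hρd]
    exact Measure.rnDeriv_withDensity _ ((hg.indicator hE).const_smul _)
  have hmem : ∀ᵐ u ∂ρ, u ∈ E :=
    Measure.ae_smul_measure (ae_restrict_mem hE) _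
  have hpos : ∀ᵐ u ∂ν, g u ≠ 0 := by
    rw [hν, ae_withDensity_iff hg]
    exact Eventually.of_forall fun u hu => hu
  -- The conditioned density is `g / ν(E)` on `E`; both factors are nonzero `ρ`-almost everywhere,
  -- so the logarithm splits.
  have hlog : (fun u => Real.logb 2 (ρ.rnDeriv volume u).toReal) =ᵐ[ρ]
      fun u => Real.logb 2 (g u).toReal - Real.logb 2 (ν.real E) := by
    filter_upwards [hac.ae_le hrn, hmem, hρν.ae_le hpos] with u hu huE hu0
    rw [hu, Pi.smul_apply, Set.indicator_of_mem huE, smul_eq_mul, ENNReal.toReal_mul,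
      ENNReal.toReal_inv, ← measureReal_def, Real.logb_mul, Real.logb_inv]
    · ring
    · exact inv_ne_zero (ENNReal.toReal_ne_zero.2 ⟨hE0, measure_ne_top _ _⟩)
    · exact ENNReal.toReal_ne_zero.2 ⟨hu0, hgtop u⟩
  have hint' : Integrable (fun u => Real.logb 2 (g u).toReal) ρ :=
    hint.restrict.smul_measure hctop
  refine ⟨⟨hac, ?_⟩, ?_⟩
  · refine (integrable_rnDeriv_smul_iff hac).2 ?_
    exact (hint'.sub (integrable_const _)).congr hlog.symm
  · have : ∫ u, entropyIntegrand ρ u = ∫ u, Real.logb 2 (ρ.rnDeriv volume u).toReal ∂ρ :=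
      integral_rnDeriv_smul hac
    rw [diffEntropy, this, integral_congr_ae hlog, integral_sub hint' (integrable_const _)]
    simp

/-- A discrete random variable almost surely takes values of positive probability. -/
theorem ae_map_singleton_ne_zero {Ω β : Type*} [MeasurableSpace Ω] [MeasurableSpace β] [Countable β]
    [MeasurableSingletonClass β] {P : Measure Ω} {X : Ω → β} (hX : Measurable X) :
    ∀ᵐ ω ∂P, P.map X {X ω} ≠ 0 := by
  refine ae_of_ae_map hX.aemeasurable (p := fun x => P.map X {x} ≠ 0) ?_
  rw [ae_iff_of_countable]
  exact fun x hx => hx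

end Conditioning

/-! ### The entropy of the posterior. -/

section Posterior

variable {Ω : Type*} [MeasurableSpace Ω] {P : Measure Ω} [IsProbabilityMeasure P] {k : ℕ}
  {f : ℝ → ℝ} {θ : Fin k → Ω → ℝ}

theorem measurable_answer {Ω : Type*} [MeasurableSpace Ω] {θ : Fin k → Ω → ℝ}
    (hθ : ∀ i, Measurable (θ i)) {A : Set ℝ} (hA : MeasurableSet A) :
    Measurable (answer θ A) :=
  Finset.measurable_sum _ fun i _ => (measurable_const.indicator hA).comp (hθ i)

theorem measurable_history {Ω : Type*} [MeasurableSpace Ω] {θ : Fin k → Ω → ℝ}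
    (hθ : ∀ i, Measurable (θ i)) {A : ℕ → Set ℝ} (hA : ∀ n, MeasurableSet (A n)) (N : ℕ) :
    Measurable (history θ A N) :=
  measurable_pi_iff.2 fun n => measurable_answer hθ (hA (n + 1))

variable (hk : 1 ≤ k) (hf : Measurable f) (hθ : ∀ i, Measurable (θ i)) (hind : iIndepFun θ P)
  (hlaw : ∀ i, P.map (θ i) = densityMeasure f)

include hk hf hθ hind hlaw

theorem map_history_singleton (N : ℕ) (x : Fin N → ℕ) :
    P.map (history θ (dyadicQuestion f) N) {x} = ∏ n, binHalf k {x n} := by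
  have hX := hasLaw_answer hk hf hθ hind hlaw
  have hi : iIndepFun (fun (n : Fin N) => answer θ (dyadicQuestion f (n + 1))) P :=
    (iIndepFun_answer hk hf hθ hind hlaw).precomp Fin.val_injective
  have := hi.map_fun_eq_pi_map fun n : Fin N => (hX n).aemeasurable
  have hpr : ∀ n : Fin N, P.map (answer θ (dyadicQuestion f (n + 1))) = binHalf k :=
    fun n => (hX n).map_eq
  have hb : IsProbabilityMeasure (binHalf k) := isProbabilityMeasure_binomial
  change P.map (fun ω (n : Fin N) => answer θ (dyadicQuestion f (n + 1)) ω) {x} = _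
  simp only [this, hpr, Measure.pi_singleton]

/-- The entropy of the posterior in terms of the likelihood of the answers and of the conditional
expectation of the log-density. -/
theorem ae_diffEntropy_posteriorLaw (hf0 : ∀ u, 0 ≤ f u)
    (hent : Integrable fun u => f u * Real.logb 2 (f u)) (N : ℕ) :
    ∀ᵐ ω ∂P, HasFiniteDiffEntropy (posteriorLaw P θ (dyadicQuestion f) N ω) ∧
      diffEntropy (posteriorLaw P θ (dyadicQuestion f) N ω) =
        ∑ n ∈ Finset.range N,
          Real.logb 2 ((binHalf k).real {answer θ (dyadicQuestion f (n + 1)) ω}) -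
        (P[fun ω' => Real.logb 2 (∏ i, f (θ i ω')) |
          MeasurableSpace.comap (history θ (dyadicQuestion f) N) inferInstance]) ω := by
  have := isProbabilityMeasure_densityMeasure hk hθ hlaw
  have hb : IsProbabilityMeasure (binHalf k) := isProbabilityMeasure_binomial
  have hA : ∀ n, MeasurableSet (dyadicQuestion f n) := measurableSet_dyadicQuestion hf
  set Y : Ω → Fin k → ℝ := fun ω i => θ i ω with hY
  have hYm : Measurable Y := measurable_pi_iff.2 hθ
  -- The history as a deterministic function of `θ`, obtained by taking the coordinates as the
  -- random variables.
  set h : (Fin k → ℝ) → Fin N → ℕ := history (fun i u => u i) (dyadicQuestion f) N with hh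
  have hhm : Measurable h := measurable_history (fun i => measurable_pi_apply i) hA N
  set L : (Fin k → ℝ) → ℝ := fun u => Real.logb 2 (∏ i, f (u i)) with hL
  have hprod : Measurable fun u : Fin k → ℝ => ∏ i, f (u i) :=
    Finset.measurable_prod _ fun i _ => hf.comp (measurable_pi_apply i)
  have hLm : Measurable L := (Real.measurable_log.comp hprod).div_const _
  have hYlaw : P.map Y = Measure.pi fun _ => densityMeasure f := by
    have := hind.map_fun_eq_pi_map fun i => (hθ i).aemeasurable
    simpa only [hlaw] using this
  have hLint : Integrable L (P.map Y) := by
    rw [hYlaw]; exact integrable_logb_prod_density hf hf0 hent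
  -- The integral of the prior log-density against the posterior is a conditional expectation, which
  -- makes martingale convergence available.
  have hce := condExp_ae_eq_integral_condDistrib (μ := P) (X := history θ (dyadicQuestion f) N)
    (measurable_history hθ hA N) hYm.aemeasurable hLm.stronglyMeasurable
    ((integrable_map_measure hLm.aestronglyMeasurable hYm.aemeasurable).1 hLint)
  filter_upwards [hce, ae_map_singleton_ne_zero (P := P) (measurable_history hθ hA N)] with ω hω hω0
  set x := history θ (dyadicQuestion f) N ω with hx
  have hmap : P.map (history θ (dyadicQuestion f) N) {x} = P.map Y (h ⁻¹' {x}) := by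
    rw [Measure.map_apply (measurable_history hθ hA N) (measurableSet_singleton _),
      Measure.map_apply hYm (hhm (measurableSet_singleton _))]
    rfl
  have hpost : posteriorLaw P θ (dyadicQuestion f) N ω =
      (P.map Y (h ⁻¹' {x}))⁻¹ • (P.map Y).restrict (h ⁻¹' {x}) := by
    rw [← hmap]
    exact condDistrib_comp_of_ne_zero hYm hhm hω0
  have hYprob : IsProbabilityMeasure (P.map Y) := Measure.isProbabilityMeasure_map hYm.aemeasurable
  have hg : Measurable fun u : Fin k → ℝ => ∏ i, ENNReal.ofReal (f (u i)) :=
    Finset.measurable_prod _ fun i _ => hf.ennreal_ofReal.comp (measurable_pi_apply i)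
  have hgL : ∀ u : Fin k → ℝ, Real.logb 2 (∏ i, ENNReal.ofReal (f (u i))).toReal = L u := fun u => by
    simp only [hL, ENNReal.toReal_prod, ENNReal.toReal_ofReal (hf0 _)]
  have key := diffEntropy_cond (ν := P.map Y) hg
    (fun u => ENNReal.prod_ne_top fun i _ => ENNReal.ofReal_ne_top)
    (by rw [hYlaw, pi_densityMeasure hf]) (hhm (measurableSet_singleton x))
    (by rw [← hmap]; exact hω0) (by simpa only [hgL] using hLint)
  rw [← hpost] at key
  refine ⟨key.1, key.2.trans ?_⟩
  simp only [hgL]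
  congr 1
  · rw [measureReal_def, ← hmap, map_history_singleton hk hf hθ hind hlaw, ENNReal.toReal_prod,
      ← Fin.sum_univ_eq_sum_range
        (fun n => Real.logb 2 ((binHalf k).real {answer θ (dyadicQuestion f (n + 1)) ω}))]
    simp only [Real.logb, ← Finset.sum_div]
    rw [Real.log_prod]
    · rfl
    · intro n _
      rw [map_history_singleton hk hf hθ hind hlaw] at hω0
      exact ENNReal.toReal_ne_zero.2
        ⟨Finset.prod_ne_zero_iff.1 hω0 n (Finset.mem_univ n), measure_ne_top _ _⟩
  · exact hω.symm

end Posterior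

/-! ### Mean and variance of the binomial log-likelihood. -/

section Binomial

theorem integral_logb_binHalf (k : ℕ) :
    ∫ j, Real.logb 2 ((binHalf k).real {j}) ∂(binHalf k) = -shannonEntropy (binHalf k) := by
  have hint : Integrable (fun j => Real.logb 2 ((binHalf k).real {j})) (binHalf k) :=
    integrable_binomial _
  rw [integral_countable hint, shannonEntropy, neg_neg]
  rfl

/-- On the support the mass at `j` is `choose k j / 2^k`, so the two functions differ by the
constant `k`. -/
theorem variance_logb_binHalf (k : ℕ) :
    Var[fun j => Real.logb 2 ((binHalf k).real {j}); binHalf k] =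
      Var[fun j : ℕ => Real.logb 2 (k.choose j : ℝ); binHalf k] := by
  have hb : IsProbabilityMeasure (binHalf k) := isProbabilityMeasure_binomial
  rw [← variance_sub_const (X := fun j : ℕ => Real.logb 2 (k.choose j : ℝ))
    Measurable.of_discrete.aestronglyMeasurable (k : ℝ)]
  refine variance_congr ?_
  have hle : ∀ᵐ j ∂(binHalf k), j ≤ k := ae_le_of_hasLaw_binomial HasLaw.id
  filter_upwards [hle] with j hj
  have hc : (k.choose j : ℝ) ≠ 0 := by exact_mod_cast (Nat.choose_pos hj).ne'
  rw [binHalf, binomial_real_singleton]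
  simp only
  rw [show (1 - 1 / 2 : ℝ) = 1 / 2 by norm_num, mul_assoc, ← pow_add, Nat.add_sub_cancel' hj,
    Real.logb_mul hc (by positivity), Real.logb_pow, one_div, Real.logb_inv,
    Real.logb_self_eq_one one_lt_two]
  ring

end Binomial

/-! ### Limit theorems with a convergent perturbation. -/

section Limits

variable {Ω : Type*} [MeasurableSpace Ω] {P : Measure Ω} [IsProbabilityMeasure P]

/-- The filtration generated by the answers. -/
noncomputable def historyFiltration {k : ℕ} (θ : Fin k → Ω → ℝ) (A : ℕ → Set ℝ)
    (h : ∀ N, Measurable (history θ A N)) :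
    Filtration ℕ (inferInstance : MeasurableSpace Ω) where
  seq N := MeasurableSpace.comap (history θ A N) inferInstance
  mono' N M hNM := by
    have hr : Measurable fun (x : Fin M → ℕ) (n : Fin N) => x (Fin.castLE hNM n) := by fun_prop
    rintro _ ⟨s, hs, rfl⟩
    exact ⟨_, hr hs, rfl⟩
  le' N := (h N).comap_le

/-- Law of large numbers and central limit theorem for sums of i.i.d. variables perturbed by an
almost surely convergent sequence. -/
theorem limits_of_ae_eq_sum_sub {D : ℕ → Ω → ℝ} {Z C : ℕ → Ω → ℝ} {c : Ω → ℝ}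
    (hD : ∀ᵐ ω ∂P, ∀ N, D N ω = ∑ n ∈ Finset.range N, Z n ω - C N ω)
    (hZ : MemLp (Z 0) 2 P) (hind : iIndepFun Z P) (hid : ∀ n, IdentDistrib (Z n) (Z 0) P P)
    (hCm : ∀ N, AEMeasurable (C N) P)
    (hC : ∀ᵐ ω ∂P, Tendsto (fun N => C N ω) atTop (𝓝 (c ω))) :
    (∀ᵐ ω ∂P, Tendsto (fun N : ℕ => D N ω / (N : ℝ)) atTop (𝓝 (P[Z 0]))) ∧
    TendstoInDistribution (fun (N : ℕ) ω => (D N ω - N * P[Z 0]) / √(N : ℝ)) atTop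
      (id : ℝ → ℝ) (fun _ => P) (gaussianReal 0 Var[Z 0; P].toNNReal) := by
  have hsqrt : Tendsto (fun N : ℕ => √(N : ℝ)) atTop atTop :=
    Real.tendsto_sqrt_atTop.comp tendsto_natCast_atTop_atTop
  constructor
  · have hlln := strong_law_ae_real Z (hZ.integrable one_le_two) (fun i j hij => hind.indepFun hij) hid
    filter_upwards [hD, hlln, hC] with ω hω hl hc
    have := hl.sub (hc.div_atTop tendsto_natCast_atTop_atTop)
    rw [sub_zero] at this
    refine this.congr fun N => ?_
    rw [hω N, sub_div]
  · have hclt := tendstoInDistribution_inv_sqrt_mul_sum_sub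
      (Y := (id : ℝ → ℝ)) (P' := gaussianReal 0 Var[Z 0; P].toNNReal) HasLaw.id hZ hind hid
    have hrm : ∀ N : ℕ, AEMeasurable (fun ω => -(C N ω / √(N : ℝ))) P :=
      fun N => ((hCm N).div_const _).neg
    -- A convergent sequence divided by `√N` tends to 0, so Slutsky's lemma leaves the Gaussian
    -- limit unchanged.
    have hr : TendstoInMeasure P (fun (N : ℕ) ω => -(C N ω / √(N : ℝ))) atTop (fun _ => (0 : ℝ)) := by
      refine tendstoInMeasure_of_tendsto_ae (fun N => (hrm N).aestronglyMeasurable) ?_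
      filter_upwards [hC] with ω hc
      simpa using (hc.div_atTop hsqrt).neg
    refine (hclt.add_of_tendstoInMeasure_const hr hrm).congr (fun N => ?_)
      (Eventually.of_forall fun x => by simp)
    filter_upwards [hD] with ω hω
    rw [Pi.add_apply, hω N]
    ring

end Limits

end TwentyQuestions

theorem theorem6 {Ω : Type*} [MeasurableSpace Ω] (P : Measure Ω) [IsProbabilityMeasure P]
    (k : ℕ) (hk : 1 ≤ k) (f₀ : ℝ → ℝ)
    (hf_meas : Measurable f₀) (hf_nonneg : ∀ u, 0 ≤ f₀ u)
    (hf_entropy : Integrable (fun u => f₀ u * Real.logb 2 (f₀ u)) volume)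
    (hf_bdd : ∃ M : ℝ, 0 < M ∧ ∀ u, f₀ u ≤ M)
    (θ : Fin k → Ω → ℝ) (hθ_meas : ∀ i, Measurable (θ i))
    (hθ_indep : iIndepFun θ P)
    (hθ_law : ∀ i, P.map (θ i) = TwentyQuestions.densityMeasure f₀) :
    (∀ᵐ ω ∂P, ∀ N : ℕ, TwentyQuestions.HasFiniteDiffEntropy
      (TwentyQuestions.posteriorLaw P θ (TwentyQuestions.dyadicQuestion f₀) N ω)) ∧
    (∀ᵐ ω ∂P, Tendsto
      (fun N : ℕ => TwentyQuestions.diffEntropy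
        (TwentyQuestions.posteriorLaw P θ (TwentyQuestions.dyadicQuestion f₀) N ω) / (N : ℝ))
      atTop (𝓝 (-TwentyQuestions.shannonEntropy (TwentyQuestions.binHalf k)))) ∧
    TendstoInDistribution
      (fun (N : ℕ) (ω : Ω) =>
        (TwentyQuestions.diffEntropy
            (TwentyQuestions.posteriorLaw P θ (TwentyQuestions.dyadicQuestion f₀) N ω) +
          (N : ℝ) * TwentyQuestions.shannonEntropy (TwentyQuestions.binHalf k)) /
          Real.sqrt (N : ℝ))
      atTop (id : ℝ → ℝ) (fun _ => P)
      (gaussianReal 0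
        (Var[fun j : ℕ => Real.logb 2 (k.choose j : ℝ);
          TwentyQuestions.binHalf k]).toNNReal) := by
  open TwentyQuestions in
  have hb : IsProbabilityMeasure (binHalf k) := isProbabilityMeasure_binomial
  have hA : ∀ n, MeasurableSet (dyadicQuestion f₀ n) := measurableSet_dyadicQuestion hf_meas
  let ℱ := historyFiltration θ (dyadicQuestion f₀) fun N => measurable_history hθ_meas hA N
  let L : Ω → ℝ := fun ω => Real.logb 2 (∏ i, f₀ (θ i ω))
  let φ : ℕ → ℝ := fun j => Real.logb 2 ((binHalf k).real {j})
  let Z : ℕ → Ω → ℝ := fun n ω => φ (answer θ (dyadicQuestion f₀ (n + 1)) ω)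
  have hX := hasLaw_answer hk hf_meas hθ_meas hθ_indep hθ_law
  have hpost := ae_all_iff.2
    (ae_diffEntropy_posteriorLaw hk hf_meas hθ_meas hθ_indep hθ_law hf_nonneg hf_entropy)
  have hφ : Measurable φ := .of_discrete
  have hid : ∀ n, IdentDistrib (Z n) (Z 0) P P := fun n =>
    IdentDistrib.comp ⟨(hX n).aemeasurable, (hX 0).aemeasurable,
      (hX n).map_eq.trans (hX 0).map_eq.symm⟩ hφ
  have hZ : MemLp (Z 0) 2 P := by
    refine MemLp.comp_of_map (f := answer θ (dyadicQuestion f₀ (0 + 1))) (g := φ) ?_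
      (hX 0).aemeasurable
    rw [(hX 0).map_eq, memLp_two_iff_integrable_sq hφ.aestronglyMeasurable]
    exact integrable_binomial _
  have hmean : P[Z 0] = -shannonEntropy (binHalf k) := by
    rw [← integral_logb_binHalf]
    exact (hX 0).integral_comp hφ.aestronglyMeasurable
  have hvar : Var[Z 0; P] = Var[fun j : ℕ => Real.logb 2 (k.choose j : ℝ); binHalf k] := by
    rw [← variance_logb_binHalf]
    have := variance_map (X := φ) (Y := answer θ (dyadicQuestion f₀ (0 + 1)))
      hφ.aemeasurable (hX 0).aemeasurable
    rw [(hX 0).map_eq] at this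
    exact this.symm
  -- The perturbation is the conditional expectation of the fixed `L` along the increasing history,
  -- convergent by Lévy's upward theorem.
  have hlim := limits_of_ae_eq_sum_sub (P := P)
    (D := fun N ω => diffEntropy (posteriorLaw P θ (dyadicQuestion f₀) N ω))
    (Z := Z) (C := fun N => P[L | ℱ N]) (hpost.mono fun ω hω N => (hω N).2) hZ
    ((iIndepFun_answer hk hf_meas hθ_meas hθ_indep hθ_law).comp (fun _ => φ) fun _ => hφ) hid
    (fun N => integrable_condExp.aemeasurable) (tendsto_ae_condExp L)
  refine ⟨hpost.mono fun ω hω N => (hω N).1, ?_, ?_⟩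
  · simpa only [hmean] using hlim.1
  · simpa only [hmean, hvar, mul_neg, sub_neg_eq_add] using hlim.2
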